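/- Let $F$ be a field of characteristic zero. The problem of classifying, up to isomorphism, the finite-dimensional nilpotent Lie algebras $L$ over $F$ of the form $L=B\ltimes W$ (that is, $B$ is a subalgebra of $L$, $L=B+W$ and $B\cap W=0$), in which $W$ is an abelian ideal of $L$ of codimension $2$, is wild: it contains the problem of classifying pairs of square matrices of the same size up to similarity. Precisely, there are a finite-dimensional Lie algebra $\mathfrak b$ over $F$, an integer $m\ge 0$, and a homomorphism of Lie algebras $\rho:\mathfrak b\to M_m(F\langle x,y\rangle)$ into the $m\times m$ matrices over the free associative algebra in two noncommuting variables (with the commutator bracket) with the following property. For $n\ge 0$ and $A,B\in M_n(F)$, let $\rho(b)(A,B)\in M_{mn}(F)$ be the block matrix obtained from $\rho(b)$ by substituting $x=A$, $y=B$, and let $L(A,B)=\mathfrak b\ltimes F^{mn}$ be the semidirect product in which $F^{mn}$ is abelian and $[b,w]=\rho(b)(A,B)\,w$ for $b\in\mathfrak b$, $w\in F^{mn}$. Then: 1. every $L(A,B)$ is a finite-dimensional nilpotent Lie algebra that is a semidirect product of a subalgebra and an abelian ideal of codimension $2$; 2. for $A,B,A',B'\in M_n(F)$, the Lie algebras $L(A,B)$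 and $L(A',B')$ are isomorphic if and only if $(A',B')=(S^{-1}AS,S^{-1}BS)$ for some nonsingular $S\in M_n(F)$; 3. if $A,B\in M_n(F)$ and $A',B'\in M_{n'}(F)$ with $n\ne n'$, then $L(A,B)$ and $L(A',B')$ are not isomorphic. -/

import Mathlib

universe u

attribute [local instance 100] LieRing.ofAssociativeRing

/-- Two pairs of `n × n` matrices are similar: `(A', B') = (S⁻¹ A S, S⁻¹ B S)` for some
nonsingular `S`. -/
def SimilarPairs {F : Type u} [Field F] {n : ℕ} (A B A' B' : Matrix (Fin n) (Fin n) F) : Prop :=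
  ∃ S : GL (Fin n) F,
    A' = (S⁻¹).val * A * S.val ∧ B' = (S⁻¹).val * B * S.val

/-- Every matrix acts by a derivation on the abelian Lie algebra `F^ι` (the bracket of `ι → F` in
Mathlib is the commutator of the commutative ring `ι → F`, hence zero), and
`Der (F^ι)` is the Lie algebra of all `ι × ι` matrices. -/
noncomputable def matrixDerivation (F : Type u) [Field F] (ι : Type) [Fintype ι] [DecidableEq ι] :
    Matrix ι ι F →ₗ⁅F⁆ LieDerivation F (ι → F) (ι → F) where
  toFun M :=
    { Matrix.toLin' M with
      leibniz' := fun a b => by simp [Ring.lie_def, mul_comm] }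
  map_add' M N := by
    ext1 v
    exact Matrix.add_mulVec M N v
  map_smul' c M := by
    ext1 v
    exact Matrix.smul_mulVec c M v
  map_lie' {M N} := by
    ext1 v
    rw [LieDerivation.commutator_apply]
    change Matrix.mulVec ⁅M, N⁆ v =
      Matrix.mulVec M (Matrix.mulVec N v) - Matrix.mulVec N (Matrix.mulVec M v)
    simp [Ring.lie_def, Matrix.sub_mulVec, Matrix.mulVec_mulVec]

/-- Evaluation of an `m × m` matrix of noncommutative polynomials in two variables at a pair `(A, B)`
of `n × n` matrices; the result is an `m × m` block matrix with blocks of size `n × n`. -/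
noncomputable def evalPair {F : Type u} [Field F] {n : ℕ} (m : ℕ)
    (A B : Matrix (Fin n) (Fin n) F) :
    Matrix (Fin m) (Fin m) (FreeAlgebra F (Fin 2)) →ₐ[F] Matrix (Fin m × Fin n) (Fin m × Fin n) F :=
  (Matrix.compAlgEquiv (Fin m) (Fin n) F F).toAlgHom.comp
    (FreeAlgebra.lift F ![A, B]).mapMatrix

/-- Let `ρ` be a representation of the Lie algebra `𝔟` by `m × m` matrices of noncommutative
polynomials in two variables. For a pair `(A, B)` of `n × n` matrices, this is the homomorphism from
`𝔟` to the derivations of the abelian Lie algebra `F^(m n)` that sends `b` to `ρ(b)(A, B)`. -/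
noncomputable def specialize {F : Type u} [Field F] {𝔟 : Type u} [LieRing 𝔟] [LieAlgebra F 𝔟]
    {m n : ℕ} (ρ : 𝔟 →ₗ⁅F⁆ Matrix (Fin m) (Fin m) (FreeAlgebra F (Fin 2)))
    (A B : Matrix (Fin n) (Fin n) F) :
    𝔟 →ₗ⁅F⁆ LieDerivation F (Fin m × Fin n → F) (Fin m × Fin n → F) :=
  (matrixDerivation F (Fin m × Fin n)).comp ((evalPair m A B).toLieHom.comp ρ)

/-- The Lie algebra `L(A, B) = 𝔟 ⋉ F^(m n)`, with `[b, w] = ρ(b)(A, B) w` for `b ∈ 𝔟` and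
`w ∈ F^(m n)`, and with `F^(m n)` abelian. Its structure constants are given uniformly in `n` by
noncommutative polynomials in the matrices `A` and `B`. -/
abbrev PairLieAlgebra {F : Type u} [Field F] {𝔟 : Type u} [LieRing 𝔟] [LieAlgebra F 𝔟]
    {m n : ℕ} (ρ : 𝔟 →ₗ⁅F⁆ Matrix (Fin m) (Fin m) (FreeAlgebra F (Fin 2)))
    (A B : Matrix (Fin n) (Fin n) F) : Type u :=
  LieAlgebra.SemiDirectSum (Fin m × Fin n → F) 𝔟 (specialize ρ A B)

/-- The problem of classifying, up to isomorphism, the Lie algebras of a class `C` is wild: it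
contains the problem of classifying pairs of square matrices of the same size up to similarity.
That is, some family `(A, B) ↦ L(A, B)` of Lie algebras of the class, polynomial in the
noncommuting matrices `A` and `B`, is such that `L(A, B)` and `L(A', B')` are isomorphic if and only
if `(A, B)` and `(A', B')` have the same size and are similar. -/
def IsWildClass (F : Type u) [Field F]
    (C : ∀ (L : Type u) [LieRing L] [LieAlgebra F L], Prop) : Prop :=
  ∃ (𝔟 : Type u) (_ : LieRing 𝔟) (_ : LieAlgebra F 𝔟) (m : ℕ)
    (ρ : 𝔟 →ₗ⁅F⁆ Matrix (Fin m) (Fin m) (FreeAlgebra F (Fin 2))),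
    Module.Finite F 𝔟 ∧
    (∀ (n : ℕ) (A B : Matrix (Fin n) (Fin n) F), C (PairLieAlgebra ρ A B)) ∧
    (∀ (n : ℕ) (A B A' B' : Matrix (Fin n) (Fin n) F),
      Nonempty (PairLieAlgebra ρ A B ≃ₗ⁅F⁆ PairLieAlgebra ρ A' B') ↔ SimilarPairs A B A' B') ∧
    (∀ (n n' : ℕ), n ≠ n' → ∀ (A B : Matrix (Fin n) (Fin n) F) (A' B' : Matrix (Fin n') (Fin n') F),
      IsEmpty (PairLieAlgebra ρ A B ≃ₗ⁅F⁆ PairLieAlgebra ρ A' B'))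

/-- `L` is a finite-dimensional nilpotent Lie algebra that is the semidirect product `L = B ⋉ W` of
a subalgebra `B` and an abelian ideal `W` of codimension 2. -/
def IsNilpotentSemidirect (F : Type u) [Field F] (L : Type u) [LieRing L] [LieAlgebra F L] :
    Prop :=
  Module.Finite F L ∧ LieRing.IsNilpotent L ∧
    ∃ (B : LieSubalgebra F L) (W : LieIdeal F L),
      IsCompl B.toSubmodule W.toSubmodule ∧ IsLieAbelian W ∧
      Module.finrank F (L ⧸ W.toSubmodule) = 2

/-! ### The graded module and its rigidity -/

section GradedModule

variable {F V : Type*} [Field F] [AddCommGroup V] [Module F V]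

/-! Take `𝔟 = F²` abelian, its basis acting by multiplication by `s` and `t` on a graded quotient
`M` of `F[s, t] ⊗ V`, where `V = F^n`; `M` is generated in degree 0 and lives in degrees at most 5.
Hence `L(A, B)` is nilpotent.

For `V ≠ 0` the ideal `M` is the centralizer of the derived algebra, so an isomorphism of Lie
algebras restricts to a linear bijection `f` of the modules, which turns `s` and `t` into nonzero
linear forms `p` and `q`. The only quartic relation, `s³t = 0`, makes `p³q` vanish, which forces `p`
to be a multiple of `s` and `q` of `t`. In the quintic relation the term `s²t³` forces the two
scalars to agree, and the terms `s⁵` and `t⁵` then say that the map induced by `f` on `M/(sM + tM) =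
V` intertwines `A` with `A'` and `B` with `B'` (`exists_conj_of_intertwines`). Conversely, the
construction is natural in `(V, A, B)`. Finally, `dim L(A, B) = 17n + 2` recovers `n`. -/

open LinearMap in
/-- Multiplication by `s` on the quotient of `F[s, t] ⊗ V` in which `s³t` and all monomials of degree
`6` vanish and `s t⁴ v = s²t³ v + s⁵ (A v) + t⁵ (B v)`. The summands of this quotient are ordered as
`1; s, t; s², st, t²; s³, s²t, st², t³; s⁴, s²t², st³, t⁴; s⁵, s²t³, t⁵`. -/
def mulS (A B : Module.End F V) : Module.End F (Fin 17 → V) :=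
  let c (i : Fin 17) : (Fin 17 → V) →ₗ[F] V := proj i
  LinearMap.pi ![0, c 0, 0, c 1, c 2, 0, c 3, c 4, c 5, 0,
    c 6, c 8, c 9, 0, c 10 + A ∘ₗ c 13, c 12 + c 13, B ∘ₗ c 13]

open LinearMap in
/-- Multiplication by `t` on the module described at `mulS`. -/
def mulT (A B : Module.End F V) : Module.End F (Fin 17 → V) :=
  let c (i : Fin 17) : (Fin 17 → V) →ₗ[F] V := proj i
  LinearMap.pi ![0, 0, c 0, 0, c 1, c 2, 0, c 3, c 4, c 5,
    0, c 7, c 8, c 9, A ∘ₗ c 12, c 11 + c 12, c 13 + B ∘ₗ c 12]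

theorem mulS_apply (A B : Module.End F V) (w : Fin 17 → V) :
    mulS A B w 0 = 0 ∧
    mulS A B w 1 = w 0 ∧
    mulS A B w 2 = 0 ∧
    mulS A B w 3 = w 1 ∧
    mulS A B w 4 = w 2 ∧
    mulS A B w 5 = 0 ∧
    mulS A B w 6 = w 3 ∧
    mulS A B w 7 = w 4 ∧
    mulS A B w 8 = w 5 ∧
    mulS A B w 9 = 0 ∧
    mulS A B w 10 = w 6 ∧
    mulS A B w 11 = w 8 ∧
    mulS A B w 12 = w 9 ∧
    mulS A B w 13 = 0 ∧
    mulS A B w 14 = w 10 + A (w 13) ∧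
    mulS A B w 15 = w 12 + w 13 ∧
    mulS A B w 16 = B (w 13) := by
  refine ⟨?_, ?_, ?_, ?_, ?_, ?_, ?_, ?_, ?_, ?_, ?_, ?_, ?_, ?_, ?_, ?_, ?_⟩ <;> rfl

theorem mulT_apply (A B : Module.End F V) (w : Fin 17 → V) :
    mulT A B w 0 = 0 ∧
    mulT A B w 1 = 0 ∧
    mulT A B w 2 = w 0 ∧
    mulT A B w 3 = 0 ∧
    mulT A B w 4 = w 1 ∧
    mulT A B w 5 = w 2 ∧
    mulT A B w 6 = 0 ∧
    mulT A B w 7 = w 3 ∧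
    mulT A B w 8 = w 4 ∧
    mulT A B w 9 = w 5 ∧
    mulT A B w 10 = 0 ∧
    mulT A B w 11 = w 7 ∧
    mulT A B w 12 = w 8 ∧
    mulT A B w 13 = w 9 ∧
    mulT A B w 14 = A (w 12) ∧
    mulT A B w 15 = w 11 + w 12 ∧
    mulT A B w 16 = w 13 + B (w 12) := by
  refine ⟨?_, ?_, ?_, ?_, ?_, ?_, ?_, ?_, ?_, ?_, ?_, ?_, ?_, ?_, ?_, ?_, ?_⟩ <;> rfl

/-- Multiplication by the linear form `b₀ s + b₁ t`. -/
def mulForm (A B : Module.End F V) (b : Fin 2 → F) : Module.End F (Fin 17 → V) :=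
  b 0 • mulS A B + b 1 • mulT A B

theorem mulForm_apply (A B : Module.End F V) (b : Fin 2 → F) (w : Fin 17 → V) (i : Fin 17) :
    mulForm A B b w i = b 0 • mulS A B w i + b 1 • mulT A B w i := rfl

theorem mulS_mulT_comm (A B : Module.End F V) (w : Fin 17 → V) :
    mulS A B (mulT A B w) = mulT A B (mulS A B w) := by
  ext i
  fin_cases i <;> simp [mulS_apply, mulT_apply]

theorem mulForm_comp_of_intertwines {A B A' B' S : Module.End F V}
    (hA : ∀ v, S (A v) = A' (S v)) (hB : ∀ v, S (B v) = B' (S v)) (b : Fin 2 → F)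
    (w : Fin 17 → V) :
    mulForm A' B' b (fun i => S (w i)) = fun i => S (mulForm A B b w i) := by
  ext i
  rw [mulForm_apply, mulForm_apply, map_add, map_smul, map_smul]
  fin_cases i <;> simp [mulS_apply, mulT_apply, hA, hB]

/-- The degrees of the summands of the module described at `mulS`. -/
def summandDegree : Fin 17 → ℕ := ![0, 1, 1, 2, 2, 2, 3, 3, 3, 3, 4, 4, 4, 4, 5, 5, 5]

theorem mulForm_eq_zero_of_degree_lt (A B : Module.End F V) (b : Fin 2 → F) {w : Fin 17 → V} {k : ℕ}
    (hw : ∀ i, summandDegree i < k → w i = 0) (i : Fin 17) (hi : summandDegree i < k + 1) :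
    mulForm A B b w i = 0 := by
  have key (j : Fin 17) (hj : summandDegree j + 1 = summandDegree i) : w j = 0 := hw j (by omega)
  clear hw hi
  rw [mulForm_apply]
  fin_cases i <;> simp (disch := decide) [key, mulS_apply, mulT_apply]

/-- A linear form raises the degree by one, and no summand has degree above 5. -/
theorem mulForm_pow_six (A B : Module.End F V) (b : Fin 2 → F) : mulForm A B b ^ 6 = 0 := by
  have key (k : ℕ) (w : Fin 17 → V) :
      ∀ i, summandDegree i < k → (mulForm A B b ^ k) w i = 0 := by
    induction k with
    | zero => simp
    | succ k ih =>
      rw [pow_succ', Module.End.mul_apply]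
      exact mulForm_eq_zero_of_degree_lt A B b ih
  refine LinearMap.ext fun w => funext fun i => ?_
  exact key 6 w i (by revert i; decide)

/-- The module is generated by its degree 0 part. The witnesses divide each basis monomial other
than `1` by `s`, or by `t` if it is a power of `t`; thus `s t⁴` never arises, nor do `A` and `B`. -/
theorem exists_mulS_add_mulT (A B : Module.End F V) (w : Fin 17 → V) :
    ∃ x y, w = Pi.single 0 (w 0) + mulS A B x + mulT A B y := by
  refine ⟨![w 1, w 3, w 4, w 6, w 7, w 8, w 10, 0, w 11, w 12, w 14, 0, w 15, 0, 0, 0, 0],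
    ![w 2, 0, w 5, 0, 0, w 9, 0, 0, 0, w 13, 0, 0, 0, w 16, 0, 0, 0], ?_⟩
  ext i
  simp only [Pi.add_apply]
  fin_cases i <;> simp [mulS_apply, mulT_apply]

theorem exists_conj_of_intertwines [FiniteDimensional F V] [Nontrivial V] {A B A' B' : Module.End F V}
    (f : (Fin 17 → V) ≃ₗ[F] (Fin 17 → V)) {p q : Fin 2 → F} (hp : p ≠ 0) (hq : q ≠ 0)
    (hS : ∀ w, f (mulS A B w) = mulForm A' B' p (f w))
    (hT : ∀ w, f (mulT A B w) = mulForm A' B' q (f w)) :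
    ∃ S : V ≃ₗ[F] V, ∀ v, S (A v) = A' (S v) ∧ S (B v) = B' (S v) := by
  let S : V →ₗ[F] V := LinearMap.proj 0 ∘ₗ f.toLinearMap ∘ₗ LinearMap.single F (fun _ => V) 0
  have hSv (v : V) : f (Pi.single 0 v) 0 = S v := rfl
  -- `f` need not respect the grading, but it maps `sM + tM` into elements without degree 0 part, so
  -- it induces `S` on `V`.
  have hS0 (w : Fin 17 → V) : f w 0 = S (w 0) := by
    obtain ⟨x, y, h⟩ := exists_mulS_add_mulT A B w
    conv_lhs => rw [h, map_add, map_add, hS, hT]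
    simp [mulForm_apply, mulS_apply, mulT_apply, hSv]
  have hsurj : Function.Surjective S := fun v =>
    ⟨f.symm (Pi.single 0 v) 0, by rw [← hS0]; simp⟩
  have hinj : Function.Injective S := LinearMap.injective_iff_surjective.2 hsurj
  -- The image under `f` of the relation `s³t = 0`.
  have quartic (v : V) : mulForm A' B' p (mulForm A' B' p (mulForm A' B' p (mulForm A' B' q
      (f (Pi.single 0 v))))) = 0 := by
    simp only [← hS, ← hT]
    rw [map_eq_zero_iff f f.injective]
    ext i
    fin_cases i <;> simp [mulS_apply, mulT_apply]
  obtain ⟨v₀, hv₀⟩ := exists_ne (0 : V)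
  have hv₀' : S v₀ ≠ 0 := (map_ne_zero_iff S hinj).2 hv₀
  -- Coordinates 10, 12 and 13 carry the coefficients of `s⁴`, `s t³` and `t⁴` in `p³q`. Only the
  -- degree 0 part of `f v₀` reaches degree 4.
  have h10 : (p 0 ^ 3 * q 0) • S v₀ = 0 := by
    rw [← hSv]
    trans; swap; exact congrFun (quartic v₀) 10
    simp [mulForm_apply, mulS_apply, mulT_apply]; module
  have h12 : (3 * p 0 * p 1 ^ 2 * q 1 + p 1 ^ 3 * q 0) • S v₀ = 0 := by
    rw [← hSv]
    trans; swap; exact congrFun (quartic v₀) 12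
    simp [mulForm_apply, mulS_apply, mulT_apply]; module
  have h13 : (p 1 ^ 3 * q 1) • S v₀ = 0 := by
    rw [← hSv]
    trans; swap; exact congrFun (quartic v₀) 13
    simp [mulForm_apply, mulS_apply, mulT_apply]; module
  simp only [smul_eq_zero, hv₀', or_false] at h10 h12 h13
  have hp1 : p 1 = 0 := by
    by_contra h
    have hq1 : q 1 = 0 := by simpa [h] using h13
    have hq0 : q 0 = 0 := by simpa [h, hq1] using h12
    exact hq (by ext i; fin_cases i <;> assumption)
  have hp0 : p 0 ≠ 0 := fun h => hp (by ext i; fin_cases i <;> assumption)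
  have hq0 : q 0 = 0 := by simpa [hp0] using h10
  have hq1 : q 1 ≠ 0 := fun h => hq (by ext i; fin_cases i <;> assumption)
  have hfS (w) : f (mulS A B w) = p 0 • mulS A' B' (f w) := by simp [hS, mulForm, hp1]
  have hfT (w) : f (mulT A B w) = q 1 • mulT A' B' (f w) := by simp [hT, mulForm, hq0]
  have quintic (v : V) : (mulS A B * mulT A B ^ 4) (Pi.single 0 v) =
      (mulS A B ^ 2 * mulT A B ^ 3) (Pi.single 0 v) + (mulS A B ^ 5) (Pi.single 0 (A v)) +
        (mulT A B ^ 5) (Pi.single 0 (B v)) := by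
    ext i
    simp only [pow_succ, pow_zero, one_mul, Module.End.mul_apply, Pi.add_apply]
    fin_cases i <;> simp [mulS_apply, mulT_apply]
  have quintic' (v : V) : (p 0 * q 1 ^ 4) • (mulS A' B' * mulT A' B' ^ 4) (f (Pi.single 0 v)) =
      (p 0 ^ 2 * q 1 ^ 3) • (mulS A' B' ^ 2 * mulT A' B' ^ 3) (f (Pi.single 0 v)) +
        p 0 ^ 5 • (mulS A' B' ^ 5) (f (Pi.single 0 (A v))) +
        q 1 ^ 5 • (mulT A' B' ^ 5) (f (Pi.single 0 (B v))) := by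
    have h := congrArg f (quintic v)
    simp only [pow_succ, pow_zero, one_mul, Module.End.mul_apply, hfS, hfT, map_add, map_smul,
      smul_smul] at h ⊢
    convert h using 1
    · ring_nf
    · ring_nf
  -- Coordinates 14, 15 and 16 belong to `s⁵`, `s²t³` and `t⁵`; on the left, `s t⁴` is rewritten by
  -- the relation for `A'` and `B'`.
  have h14 (v : V) : (p 0 * q 1 ^ 4) • A' (S v) = p 0 ^ 5 • S (A v) := by
    simpa [pow_succ, mulS_apply, mulT_apply, hSv] using congrFun (quintic' v) 14
  have h15 (v : V) : (p 0 * q 1 ^ 4) • S v = (p 0 ^ 2 * q 1 ^ 3) • S v := by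
    simpa [pow_succ, mulS_apply, mulT_apply, hSv] using congrFun (quintic' v) 15
  have h16 (v : V) : (p 0 * q 1 ^ 4) • B' (S v) = q 1 ^ 5 • S (B v) := by
    simpa [pow_succ, mulS_apply, mulT_apply, hSv] using congrFun (quintic' v) 16
  have hpq : p 0 = q 1 := by
    have h := smul_left_injective F hv₀' (h15 v₀)
    have : (p 0 * q 1 ^ 3) * q 1 = (p 0 * q 1 ^ 3) * p 0 := by linear_combination h
    exact (mul_left_cancel₀ (by positivity) this).symm
  refine ⟨LinearEquiv.ofBijective S ⟨hinj, hsurj⟩, fun v => ⟨?_, ?_⟩⟩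
  · have h := h14 v
    rw [hpq, ← pow_succ'] at h
    exact (smul_right_injective V (pow_ne_zero 5 hq1) h).symm
  · have h := h16 v
    rw [hpq, ← pow_succ'] at h
    exact (smul_right_injective V (pow_ne_zero 5 hq1) h).symm

/-- `s²` and `st` are independent in degree 2, so multiplying by `s` already detects both
coefficients of `b`. -/
theorem eq_zero_of_mulForm_mul [Nontrivial V] {A B : Module.End F V} {b : Fin 2 → F}
    (h : ∀ c w, mulForm A B b (mulForm A B c w) = 0) : b = 0 := by
  obtain ⟨v, hv⟩ := exists_ne (0 : V)
  have h3 := congrFun (h ![1, 0] (Pi.single 0 v)) 3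
  have h4 := congrFun (h ![1, 0] (Pi.single 0 v)) 4
  ext i
  fin_cases i
  · simpa [mulForm_apply, mulS_apply, mulT_apply, hv] using h3
  · simpa [mulForm_apply, mulS_apply, mulT_apply, hv] using h4

end GradedModule

/-! ### Matrices with noncommuting entries -/

section MatrixModel

variable {F K V : Type*} [Field F] [Ring K] [Algebra F K] [AddCommGroup V] [Module F V]

/-- The matrix of `mulS`, with `x` and `y` in place of the two endomorphisms. -/
def matrixS (x y : K) : Matrix (Fin 17) (Fin 17) K :=
  Matrix.of ![0, Pi.single 0 1, 0, Pi.single 1 1, Pi.single 2 1, 0,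
    Pi.single 3 1, Pi.single 4 1, Pi.single 5 1, 0,
    Pi.single 6 1, Pi.single 8 1, Pi.single 9 1, 0,
    Pi.single 10 1 + Pi.single 13 x, Pi.single 12 1 + Pi.single 13 1, Pi.single 13 y]

/-- The matrix of `mulT`, with `x` and `y` in place of the two endomorphisms. -/
def matrixT (x y : K) : Matrix (Fin 17) (Fin 17) K :=
  Matrix.of ![0, 0, Pi.single 0 1, 0, Pi.single 1 1, Pi.single 2 1,
    0, Pi.single 3 1, Pi.single 4 1, Pi.single 5 1,
    0, Pi.single 7 1, Pi.single 8 1, Pi.single 9 1,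
    Pi.single 12 x, Pi.single 11 1 + Pi.single 12 1, Pi.single 13 1 + Pi.single 12 y]

theorem sum_algHom_single_apply (φ : K →ₐ[F] Module.End F V) (i : Fin 17) (x : K)
    (w : Fin 17 → V) : ∑ j, φ ((Pi.single i x : Fin 17 → K) j) (w j) = φ x (w i) := by
  rw [Finset.sum_eq_single i (by intro j _ hj; simp [hj]) (by simp), Pi.single_eq_same]

theorem sum_algHom_matrixS_apply (φ : K →ₐ[F] Module.End F V) (x y : K) (w : Fin 17 → V)
    (i : Fin 17) : ∑ j, φ (matrixS x y i j) (w j) = mulS (φ x) (φ y) w i := by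
  fin_cases i <;>
    simp [matrixS, mulS_apply, Finset.sum_add_distrib, sum_algHom_single_apply]

theorem sum_algHom_matrixT_apply (φ : K →ₐ[F] Module.End F V) (x y : K) (w : Fin 17 → V)
    (i : Fin 17) : ∑ j, φ (matrixT x y i j) (w j) = mulT (φ x) (φ y) w i := by
  fin_cases i <;>
    simp [matrixT, mulT_apply, Finset.sum_add_distrib, sum_algHom_single_apply]

/-- This is `mulS_mulT_comm` for `V = K`, with `x` and `y` acting by left multiplication; they need
not commute. -/
theorem matrixS_mul_matrixT (F : Type*) {K : Type*} [Field F] [Ring K] [Algebra F K] (x y : K) :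
    matrixS x y * matrixT x y = matrixT x y * matrixS x y := by
  have hS (w : Fin 17 → K) :
      (matrixS x y).mulVec w = mulS (Algebra.lmul F K x) (Algebra.lmul F K y) w :=
    funext fun i => sum_algHom_matrixS_apply (Algebra.lmul F K) x y w i
  have hT (w : Fin 17 → K) :
      (matrixT x y).mulVec w = mulT (Algebra.lmul F K x) (Algebra.lmul F K y) w :=
    funext fun i => sum_algHom_matrixT_apply (Algebra.lmul F K) x y w i
  refine Matrix.mulVec_injective (funext fun w => ?_)
  rw [← Matrix.mulVec_mulVec, ← Matrix.mulVec_mulVec, hS, hT, hS, hT, mulS_mulT_comm]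

end MatrixModel

/-! ### The representation of the plane and its specializations -/

section LieAlgebraModel

variable {F : Type u} [Field F]

/-- The commutator on the commutative ring `Fin 2 → F` vanishes. -/
theorem pi_lie_eq_zero {ι : Type*} (a b : ι → F) : ⁅a, b⁆ = 0 := by
  simp [Ring.lie_def, mul_comm]

variable (F) in
/-- The representation of the abelian Lie algebra `F²` in which the two basis vectors act as
`mulS` and `mulT`. -/
noncomputable def planeRep :
    (Fin 2 → F) →ₗ⁅F⁆ Matrix (Fin 17) (Fin 17) (FreeAlgebra F (Fin 2)) where
  toFun b := b 0 • matrixS (FreeAlgebra.ι F 0) (FreeAlgebra.ι F 1) +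
    b 1 • matrixT (FreeAlgebra.ι F 0) (FreeAlgebra.ι F 1)
  map_add' b c := by simp only [Pi.add_apply]; module
  map_smul' c b := by simp only [Pi.smul_apply, smul_eq_mul, RingHom.id_apply]; module
  map_lie' {b c} := by
    rw [pi_lie_eq_zero, Ring.lie_def]
    simp only [add_mul, mul_add, smul_mul_smul_comm, matrixS_mul_matrixT F]
    simp only [Pi.zero_apply]
    module

theorem planeRep_apply (b : Fin 2 → F) :
    planeRep F b = b 0 • matrixS (FreeAlgebra.ι F 0) (FreeAlgebra.ι F 1) +
      b 1 • matrixT (FreeAlgebra.ι F 0) (FreeAlgebra.ι F 1) := rfl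

theorem curry_specialize_planeRep {n : ℕ} (A B : Matrix (Fin n) (Fin n) F) (b : Fin 2 → F)
    (w : Fin 17 × Fin n → F) :
    Function.curry (specialize (planeRep F) A B b w) =
      mulForm A.toLin' B.toLin' b (Function.curry w) := by
  let φ : FreeAlgebra F (Fin 2) →ₐ[F] Module.End F (Fin n → F) :=
    (Matrix.toLinAlgEquiv' : Matrix (Fin n) (Fin n) F ≃ₐ[F] _).toAlgHom.comp
      (FreeAlgebra.lift F ![A, B])
  have h0 : φ (FreeAlgebra.ι F 0) = A.toLin' := by
    simp only [φ, AlgHom.comp_apply, FreeAlgebra.lift_ι_apply]; rfl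
  have h1 : φ (FreeAlgebra.ι F 1) = B.toLin' := by
    simp only [φ, AlgHom.comp_apply, FreeAlgebra.lift_ι_apply]; rfl
  have hφ (i : Fin 17) : Function.curry (specialize (planeRep F) A B b w) i =
      ∑ j, φ (planeRep F b i j) (Function.curry w j) := by
    ext k
    refine Eq.trans ?_ (Finset.sum_apply k Finset.univ fun j =>
      φ (planeRep F b i j) (Function.curry w j)).symm
    change ∑ p : Fin 17 × Fin n, evalPair 17 A B (planeRep F b) (i, k) p * w p = _
    rw [Fintype.sum_prod_type]
    rfl
  ext1 i
  rw [hφ, mulForm_apply, ← h0, ← h1, ← sum_algHom_matrixS_apply, ← sum_algHom_matrixT_apply,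
    planeRep_apply, Finset.smul_sum, Finset.smul_sum, ← Finset.sum_add_distrib]
  refine Finset.sum_congr rfl fun j _ => ?_
  rw [Matrix.add_apply, Matrix.smul_apply, Matrix.smul_apply, map_add, map_smul, map_smul]
  rfl

end LieAlgebraModel

/-! ### The Lie algebras `L(A, B)` and their isomorphisms -/

section PlaneLieAlgebra

open LieAlgebra

variable {F : Type u} [Field F] {n : ℕ}

theorem lie_planeLieAlgebra (A B : Matrix (Fin n) (Fin n) F)
    (x y : PairLieAlgebra (planeRep F) A B) :
    ⁅x, y⁆ = ⟨specialize (planeRep F) A B x.right y.left -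
      specialize (planeRep F) A B y.right x.left, 0⟩ := by
  rw [SemiDirectSum.lie_eq_mk, pi_lie_eq_zero, pi_lie_eq_zero, zero_add]

theorem finite_semiDirectSum {K L : Type*} [LieRing K] [LieAlgebra F K] [LieRing L]
    [LieAlgebra F L] [Module.Finite F K] [Module.Finite F L] (ψ : L →ₗ⁅F⁆ LieDerivation F K K) :
    Module.Finite F (SemiDirectSum K L ψ) :=
  Module.Finite.equiv (SemiDirectSum.toProdl ψ).symm

theorem finrank_semiDirectSum_quotient_ker_projr {K L : Type*} [LieRing K] [LieAlgebra F K]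
    [LieRing L] [LieAlgebra F L] (ψ : L →ₗ⁅F⁆ LieDerivation F K K) :
    Module.finrank F (SemiDirectSum K L ψ ⧸ (SemiDirectSum.projr ψ).ker.toSubmodule) =
      Module.finrank F L :=
  LinearEquiv.finrank_eq <| LinearMap.quotKerEquivOfSurjective
    (SemiDirectSum.projr ψ : SemiDirectSum K L ψ →ₗ[F] L) (SemiDirectSum.projr_surjective ψ)

theorem isCompl_range_inr_ker_projr {K L : Type*} [LieRing K] [LieAlgebra F K]
    [LieRing L] [LieAlgebra F L] (ψ : L →ₗ⁅F⁆ LieDerivation F K K) :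
    IsCompl (SemiDirectSum.inr ψ).range.toSubmodule (SemiDirectSum.projr ψ).ker.toSubmodule := by
  refine IsCompl.of_eq ?_ ?_
  · rw [Submodule.eq_bot_iff]
    rintro _ ⟨⟨b, rfl⟩, h⟩
    have hb : b = 0 := h
    rw [hb]
    exact map_zero (SemiDirectSum.inr ψ)
  · rw [Submodule.eq_top_iff']
    intro x
    refine Submodule.mem_sup.2 ⟨⟨0, x.right⟩, ⟨x.right, rfl⟩, ⟨x.left, 0⟩, rfl, ?_⟩
    simp

theorem specialize_planeRep_iterate (A B : Matrix (Fin n) (Fin n) F) (b : Fin 2 → F) (k : ℕ)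
    (w : Fin 17 × Fin n → F) :
    Function.curry ((specialize (planeRep F) A B b)^[k] w) =
      (mulForm A.toLin' B.toLin' b ^ k) (Function.curry w) := by
  induction k with
  | zero => rfl
  | succ k ih =>
    rw [Function.iterate_succ_apply', curry_specialize_planeRep, ih, pow_succ',
      Module.End.mul_apply]

theorem specialize_planeRep_iterate_six (A B : Matrix (Fin n) (Fin n) F) (b : Fin 2 → F)
    (w : Fin 17 × Fin n → F) : (specialize (planeRep F) A B b)^[6] w = 0 := by
  have h := specialize_planeRep_iterate A B b 6 w
  rw [mulForm_pow_six] at h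
  ext ⟨i, k⟩
  exact congrFun (congrFun h i) k

theorem isNilpotent_planeLieAlgebra (A B : Matrix (Fin n) (Fin n) F) :
    LieRing.IsNilpotent (PairLieAlgebra (planeRep F) A B) := by
  have := finite_semiDirectSum (specialize (planeRep F) A B)
  -- By Engel's theorem it is enough that each `ad x` is nilpotent.
  rw [LieAlgebra.isNilpotent_iff_forall (R := F)]
  intro x
  have key (k : ℕ) (w : Fin 17 × Fin n → F) :
      (ad F (PairLieAlgebra (planeRep F) A B) x ^ k) ⟨w, 0⟩ =
        ⟨(specialize (planeRep F) A B x.right)^[k] w, 0⟩ := by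
    induction k with
    | zero => rfl
    | succ k ih =>
      rw [pow_succ', Module.End.mul_apply, ih, ad_apply, lie_planeLieAlgebra,
        Function.iterate_succ_apply']
      simp
  -- One bracket lands in the abelian ideal, where six more give zero.
  refine ⟨7, LinearMap.ext fun y => ?_⟩
  rw [pow_succ, Module.End.mul_apply, ad_apply, lie_planeLieAlgebra, key,
    specialize_planeRep_iterate_six]
  rfl

theorem isNilpotentSemidirect_planeLieAlgebra (A B : Matrix (Fin n) (Fin n) F) :
    IsNilpotentSemidirect F (PairLieAlgebra (planeRep F) A B) := by
  refine ⟨finite_semiDirectSum _, isNilpotent_planeLieAlgebra A B,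
    (SemiDirectSum.inr (specialize (planeRep F) A B)).range,
    (SemiDirectSum.projr (specialize (planeRep F) A B)).ker,
    isCompl_range_inr_ker_projr _, ⟨?_⟩, ?_⟩
  · rintro ⟨x, hx⟩ ⟨y, hy⟩
    have hx' : x.right = 0 := hx
    have hy' : y.right = 0 := hy
    apply Subtype.ext
    change ⁅x, y⁆ = 0
    rw [lie_planeLieAlgebra, hx', hy']
    simp
  · rw [finrank_semiDirectSum_quotient_ker_projr]
    simp

/-- The abelian ideal annihilates all brackets, a property that isomorphisms preserve; in the
target, only elements of the ideal have it, because `n ≠ 0`. -/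
theorem right_equiv_eq_zero [NeZero n] {m : ℕ} {A B : Matrix (Fin m) (Fin m) F}
    {A' B' : Matrix (Fin n) (Fin n) F}
    (e : PairLieAlgebra (planeRep F) A B ≃ₗ⁅F⁆ PairLieAlgebra (planeRep F) A' B')
    {x : PairLieAlgebra (planeRep F) A B} (hx : x.right = 0) : (e x).right = 0 := by
  apply eq_zero_of_mulForm_mul (V := Fin n → F) (A := A'.toLin') (B := B'.toLin')
  intro c w
  have h0 (y z : PairLieAlgebra (planeRep F) A B) : ⁅x, ⁅y, z⁆⁆ = 0 := by
    rw [lie_planeLieAlgebra, lie_planeLieAlgebra, hx]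
    simp
  have h : ⁅e x, ⁅(⟨0, c⟩ : PairLieAlgebra (planeRep F) A' B'),
      (⟨Function.uncurry w, 0⟩ : PairLieAlgebra (planeRep F) A' B')⁆⁆ = 0 := by
    rw [← e.apply_symm_apply ⟨0, c⟩, ← e.apply_symm_apply ⟨Function.uncurry w, 0⟩,
      ← LieEquiv.map_lie, ← LieEquiv.map_lie, h0, map_zero]
  rw [lie_planeLieAlgebra, lie_planeLieAlgebra] at h
  have h' := congrArg (fun z => Function.curry (SemiDirectSum.left z)) h
  simp only [map_zero, LieDerivation.zero_apply, sub_zero,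
    curry_specialize_planeRep] at h'
  exact h'

theorem similarPairs_of_equiv [NeZero n] {A B A' B' : Matrix (Fin n) (Fin n) F}
    (e : PairLieAlgebra (planeRep F) A B ≃ₗ⁅F⁆ PairLieAlgebra (planeRep F) A' B') :
    SimilarPairs A B A' B' := by
  have hl (x) (hx : x.right = 0) : e x = ⟨(e x).left, 0⟩ :=
    SemiDirectSum.ext rfl (right_equiv_eq_zero e hx)
  have hl' (x) (hx : x.right = 0) : e.symm x = ⟨(e.symm x).left, 0⟩ :=
    SemiDirectSum.ext rfl (right_equiv_eq_zero e.symm hx)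
  let f : (Fin 17 × Fin n → F) ≃ₗ[F] (Fin 17 × Fin n → F) :=
    { SemiDirectSum.projl (specialize (planeRep F) A' B') ∘ₗ e.toLinearEquiv.toLinearMap ∘ₗ
        (SemiDirectSum.inl (specialize (planeRep F) A B)).toLinearMap with
      invFun w := (e.symm ⟨w, 0⟩).left
      left_inv w := by
        change (e.symm ⟨(e ⟨w, 0⟩).left, 0⟩).left = w
        rw [← hl _ rfl, e.symm_apply_apply]
      right_inv w := by
        change (e ⟨(e.symm ⟨w, 0⟩).left, 0⟩).left = w
        rw [← hl' _ rfl, e.apply_symm_apply] }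
  have hf (w) : (⟨f w, 0⟩ : PairLieAlgebra (planeRep F) A' B') = e ⟨w, 0⟩ := (hl _ rfl).symm
  have hfb (b : Fin 2 → F) (w) : f (specialize (planeRep F) A B b w) =
      specialize (planeRep F) A' B' (e ⟨0, b⟩).right (f w) := by
    have h := congrArg SemiDirectSum.left (LieEquiv.map_lie e ⟨0, b⟩ ⟨w, 0⟩)
    rw [lie_planeLieAlgebra, lie_planeLieAlgebra, ← hf w] at h
    refine Eq.trans ?_ (h.trans ?_)
    · simp [f]
    · simp
  have hne (b : Fin 2 → F) (hb : b ≠ 0) : (e ⟨0, b⟩).right ≠ 0 := fun h => hb <| by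
    have := hl' (e ⟨0, b⟩) h
    rw [e.symm_apply_apply] at this
    exact congrArg SemiDirectSum.right this
  let f' : (Fin 17 → Fin n → F) ≃ₗ[F] (Fin 17 → Fin n → F) :=
    (LinearEquiv.curry F F (Fin 17) (Fin n)).symm ≪≫ₗ f ≪≫ₗ LinearEquiv.curry F F (Fin 17) (Fin n)
  have hf' (b : Fin 2 → F) (w) : f' (mulForm A.toLin' B.toLin' b w) =
      mulForm A'.toLin' B'.toLin' (e ⟨0, b⟩).right (f' w) := by
    have h : f' (Function.curry (specialize (planeRep F) A B b (Function.uncurry w))) =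
        Function.curry (specialize (planeRep F) A' B' (e ⟨0, b⟩).right (f (Function.uncurry w))) :=
      congrArg Function.curry (hfb b (Function.uncurry w))
    rw [curry_specialize_planeRep, curry_specialize_planeRep] at h
    exact h
  obtain ⟨S, hS⟩ := exists_conj_of_intertwines f' (hne ![1, 0] (by simp)) (hne ![0, 1] (by simp))
    (fun w => by simpa [mulForm] using hf' ![1, 0] w)
    (fun w => by simpa [mulForm] using hf' ![0, 1] w)
  -- Since `A' = S A S⁻¹`, the conjugating matrix required is that of `S⁻¹`.
  refine ⟨⟨S.symm.toLinearMap.toMatrix', S.toLinearMap.toMatrix', ?_, ?_⟩, ?_, ?_⟩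
  · rw [← LinearMap.toMatrix'_comp]; simp
  · rw [← LinearMap.toMatrix'_comp]; simp
  · apply Matrix.toLin'.injective
    refine LinearMap.ext fun v => ?_
    change _ = Matrix.toLin' (S.toLinearMap.toMatrix' * A * S.symm.toLinearMap.toMatrix') v
    simp only [Matrix.toLin'_mul, Matrix.toLin'_toMatrix', LinearMap.comp_apply]
    simpa using (hS (S.symm v)).1.symm
  · apply Matrix.toLin'.injective
    refine LinearMap.ext fun v => ?_
    change _ = Matrix.toLin' (S.toLinearMap.toMatrix' * B * S.symm.toLinearMap.toMatrix') v
    simp only [Matrix.toLin'_mul, Matrix.toLin'_toMatrix', LinearMap.comp_apply]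
    simpa using (hS (S.symm v)).2.symm

/-- Equivariant linear equivalences of abelian ideals extend to semidirect sums. -/
def planeLieEquiv {A B A' B' : Matrix (Fin n) (Fin n) F}
    (f : (Fin 17 × Fin n → F) ≃ₗ[F] (Fin 17 × Fin n → F))
    (hf : ∀ b w, f (specialize (planeRep F) A B b w) = specialize (planeRep F) A' B' b (f w)) :
    PairLieAlgebra (planeRep F) A B ≃ₗ⁅F⁆ PairLieAlgebra (planeRep F) A' B' where
  toFun x := ⟨f x.left, x.right⟩
  invFun x := ⟨f.symm x.left, x.right⟩
  left_inv x := by simp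
  right_inv x := by simp
  map_add' x y := by simp
  map_smul' c x := by simp
  map_lie' {x y} := by simp [pi_lie_eq_zero, hf]

theorem SimilarPairs.nonempty_equiv {A B A' B' : Matrix (Fin n) (Fin n) F}
    (h : SimilarPairs A B A' B') :
    Nonempty (PairLieAlgebra (planeRep F) A B ≃ₗ⁅F⁆ PairLieAlgebra (planeRep F) A' B') := by
  obtain ⟨S, hA, hB⟩ := h
  let σ : (Fin n → F) ≃ₗ[F] (Fin n → F) := Matrix.toLin'OfInv S.val_inv S.inv_val
  have hσ (v) : σ v = (S⁻¹).val.mulVec v := rfl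
  have hσA (v) : σ (A.toLin' v) = A'.toLin' (σ v) := by
    simp [hσ, hA, Matrix.mulVec_mulVec, Matrix.mul_assoc]
  have hσB (v) : σ (B.toLin' v) = B'.toLin' (σ v) := by
    simp [hσ, hB, Matrix.mulVec_mulVec, Matrix.mul_assoc]
  let f : (Fin 17 × Fin n → F) ≃ₗ[F] (Fin 17 × Fin n → F) :=
    LinearEquiv.curry F F (Fin 17) (Fin n) ≪≫ₗ LinearEquiv.piCongrRight (fun _ => σ) ≪≫ₗ
      (LinearEquiv.curry F F (Fin 17) (Fin n)).symm
  have hf (w) : Function.curry (f w) = fun i => σ (Function.curry w i) := rfl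
  refine ⟨planeLieEquiv f fun b w => ?_⟩
  refine Function.LeftInverse.injective Function.uncurry_curry ?_
  rw [hf, curry_specialize_planeRep, curry_specialize_planeRep, hf]
  exact (mulForm_comp_of_intertwines (S := σ.toLinearMap) hσA hσB b (Function.curry w)).symm

theorem finrank_planeLieAlgebra (A B : Matrix (Fin n) (Fin n) F) :
    Module.finrank F (PairLieAlgebra (planeRep F) A B) = 17 * n + 2 := by
  rw [(SemiDirectSum.toProdl (specialize (planeRep F) A B)).finrank_eq]
  simp

end PlaneLieAlgebra

theorem lemma2 (F : Type u) [Field F] [CharZero F] :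
    IsWildClass F (fun L [LieRing L] [LieAlgebra F L] => IsNilpotentSemidirect F L) := by
  refine ⟨Fin 2 → F, inferInstance, inferInstance, 17, planeRep F, inferInstance,
    fun n A B => isNilpotentSemidirect_planeLieAlgebra A B,
    fun n A B A' B' => ⟨fun ⟨e⟩ => ?_, SimilarPairs.nonempty_equiv⟩,
    fun n n' hn A B A' B' => ⟨fun e => hn ?_⟩⟩
  -- For `n = 0` the ideal is zero and the argument above does not apply, but all matrices coincide.
  · obtain rfl | hn := Nat.eq_zero_or_pos n
    · exact ⟨1, Subsingleton.elim _ _, Subsingleton.elim _ _⟩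
    · have : NeZero n := ⟨hn.ne'⟩
      exact similarPairs_of_equiv e
  · have h := e.toLinearEquiv.finrank_eq
    rw [finrank_planeLieAlgebra, finrank_planeLieAlgebra] at h
    omega
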